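/- A projective plane consists of points and lines such that two distinct points lie on exactly one common line, two distinct lines have exactly one common point, and there are four points no three of which are collinear. An affine plane consists of points and lines such that two distinct points lie on exactly one common line, every line has at least two points, there are three distinct points not on a line, and through a point $A$ outside a line $g$ there is exactly one line that does not meet $g$. Every affine plane is extended to a projective plane by adjoining one ideal point to each class of parallel lines and one line at infinity, which consists of the ideal points. Pappus' theorem for a projective plane is the assertion: let $g\neq h$ be lines, let $A_1,A_3,A_5$ be distinct points of $g$ and $A_2,A_4,A_6$ distinct points of $h$, all different from $g\cap h$; then the intersections of opposite sides $A_1A_2\cap A_4A_5$, $A_2A_3\cap A_5A_6$, $A_3A_4\cap A_6A_1$ of the hexagon $A_1A_2A_3A_4A_5A_6$ lie on a line. A perspectivity from a line $g$ to a line $h$ with centre $S$ (a point on neither line) is the bijection from the points of $g$ to the points of $h$ that maps $X$ to $SX\cap h$. A projectivity is a product of finitely many perspectivities $g=g_0\to g_1\to\dots\to g_n=g'$ (the identity of a line is included, as the empty product). The fundamental theorem of projective geometry for a projective plane is the assertion: for all lines $g,g'$ (possibly equal), all distinct points $A,B,C$ of $g$ and all distinct points $A',B',C'$ of $g'$ there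 is exactly one projectivity from $g$ to $g'$ that maps $A,B,C$ to $A',B',C'$ respectively. Theorem. (1) In every projective plane, Pappus' theorem holds if and only if the fundamental theorem of projective geometry holds. (2) In every affine plane, extended by its ideal points and the line at infinity, Pappus' theorem holds if and only if the fundamental theorem of projective geometry holds. -/

import Mathlib

universe u v

namespace PappusFundamental

/-! ## Collinearity, Pappus' theorem, projectivities

Everything in this part is stated for a set `P` of points and a set `L` of lines with an incidence
relation `X ∈ l`. -/

section Incidence

variable (P : Type u) (L : Type v) [Membership P L]

/-- The points `X`, `Y`, `Z` lie on a common line. -/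
def Collin (X Y Z : P) : Prop :=
  ∃ l : L, X ∈ l ∧ Y ∈ l ∧ Z ∈ l

/-- Pappus' theorem: if the vertices `A₁, A₂, A₃, A₄, A₅, A₆` of a hexagon lie alternately on two
distinct lines `g` and `h` (three distinct vertices on each, none of them on both lines), then
the intersections `U`, `V`, `W` of the opposite sides `A₁A₂, A₄A₅`, and `A₂A₃, A₅A₆`, and
`A₃A₄, A₆A₁` lie on a line. -/
def PappusTheorem : Prop :=
  ∀ (g h : L) (A₁ A₂ A₃ A₄ A₅ A₆ U V W : P), g ≠ h →
    A₁ ∈ g → A₃ ∈ g → A₅ ∈ g → A₁ ∉ h → A₃ ∉ h → A₅ ∉ h →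
    A₂ ∈ h → A₄ ∈ h → A₆ ∈ h → A₂ ∉ g → A₄ ∉ g → A₆ ∉ g →
    A₁ ≠ A₃ → A₁ ≠ A₅ → A₃ ≠ A₅ → A₂ ≠ A₄ → A₂ ≠ A₆ → A₄ ≠ A₆ →
    Collin P L A₁ A₂ U → Collin P L A₄ A₅ U →
    Collin P L A₂ A₃ V → Collin P L A₅ A₆ V →
    Collin P L A₃ A₄ W → Collin P L A₆ A₁ W →
    Collin P L U V W

/-- The points of the line `g`. -/
abbrev PointsOn (g : L) : Type u := {X : P // X ∈ g}

variable {P L}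

/-- A one-to-one correspondence between the points of `g` and those of `h` is a perspectivity if
there is a centre `S`, on neither line, such that each point `X` of `g` is mapped to a point
of `h` on the line joining `S` and `X`. -/
def IsPerspectivity {g h : L} (f : PointsOn P L g ≃ PointsOn P L h) : Prop :=
  ∃ S : P, S ∉ g ∧ S ∉ h ∧ ∀ X : PointsOn P L g, Collin P L S X.1 (f X).1

/-- The projectivities between lines are the products of finitely many perspectivities. -/
inductive IsProjectivity : ∀ {g h : L}, (PointsOn P L g ≃ PointsOn P L h) → Prop
  | refl (g : L) : IsProjectivity (Equiv.refl (PointsOn P L g))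
  | step {g h k : L} {f : PointsOn P L g ≃ PointsOn P L h} {p : PointsOn P L h ≃ PointsOn P L k} :
      IsProjectivity f → IsPerspectivity p → IsProjectivity (f.trans p)

variable (P L)

/-- The fundamental theorem of projective geometry: for three distinct points `A, B, C` of a
line `g` and three distinct points `A', B', C'` of a line `g'` (possibly equal to `g`) there is
exactly one projectivity from `g` to `g'` that maps `A, B, C` to `A', B', C'`. -/
def FundamentalTheorem : Prop :=
  ∀ (g g' : L) (A B C : PointsOn P L g) (A' B' C' : PointsOn P L g'),
    A ≠ B → A ≠ C → B ≠ C → A' ≠ B' → A' ≠ C' → B' ≠ C' →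
    ∃! f : PointsOn P L g ≃ PointsOn P L g',
      IsProjectivity f ∧ f A = A' ∧ f B = B' ∧ f C = C'

end Incidence

/-! ## Affine planes and their extension by ideal elements -/

/-- An affine plane: the plane incidence axioms and the parallel axiom. -/
class AffinePlane (P : Type u) (L : Type v) [Membership P L] : Prop where
  exists_line : ∀ A B : P, A ≠ B → ∃ l : L, A ∈ l ∧ B ∈ l
  line_unique : ∀ (A B : P) (l m : L), A ≠ B → A ∈ l → B ∈ l → A ∈ m → B ∈ m → l = m
  exists_two_points : ∀ l : L, ∃ A B : P, A ≠ B ∧ A ∈ l ∧ B ∈ l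
  exists_noncollinear : ∃ A B C : P, A ≠ B ∧ A ≠ C ∧ B ≠ C ∧ ¬ Collin P L A B C
  existsUnique_parallel : ∀ (g : L) (A : P), A ∉ g →
    ∃! h : L, A ∈ h ∧ ∀ X : P, X ∈ g → X ∉ h

section Extension

variable (P : Type u) (L : Type v) [Membership P L]

/-- Two lines are parallel if they coincide or have no common point. -/
def Parallel (g h : L) : Prop := g = h ∨ ∀ X : P, X ∈ g → X ∉ h

variable [AffinePlane P L]

theorem parallel_equivalence : Equivalence (Parallel P L) where
  refl g := Or.inl rfl
  symm := by
    rintro g h (rfl | hd)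
    · exact Or.inl rfl
    · exact Or.inr fun X hX hX' => hd X hX' hX
  trans := by
    rintro g h k (rfl | h₁) (rfl | h₂)
    · exact Or.inl rfl
    · exact Or.inr h₂
    · exact Or.inr h₁
    · by_cases hgk : g = k
      · exact Or.inl hgk
      · refine Or.inr fun X hXg hXk => hgk ?_
        exact (AffinePlane.existsUnique_parallel h X (h₁ X hXg)).unique
          ⟨hXg, fun Y hY hY' => h₁ Y hY' hY⟩ ⟨hXk, h₂⟩

/-- Parallelism as an equivalence relation on the lines. -/
def parallelSetoid : Setoid L := ⟨Parallel P L, parallel_equivalence P L⟩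

/-- The points of the extended plane: the points of the affine plane, and one ideal point for
each class of parallel lines. -/
inductive ExtPoint : Type (max u v)
  | proper (X : P) : ExtPoint
  | ideal (d : Quotient (parallelSetoid P L)) : ExtPoint

/-- The lines of the extended plane: the lines of the affine plane, and the line at infinity. -/
inductive ExtLine : Type v
  | proper (l : L) : ExtLine
  | infinity : ExtLine

/-- A line of the affine plane is extended by the ideal point of its class of parallels;
the line at infinity consists of the ideal points. -/
def ExtIncident : ExtLine L → ExtPoint P L → Prop
  | .proper l, .proper X => X ∈ l
  | .proper l, .ideal d => d = Quotient.mk (parallelSetoid P L) l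
  | .infinity, .proper _ => False
  | .infinity, .ideal _ => True

instance instMembershipExt : Membership (ExtPoint P L) (ExtLine L) := ⟨ExtIncident P L⟩

variable {P L}

theorem proper_mem_proper {X : P} {l : L} :
    (ExtPoint.proper X : ExtPoint P L) ∈ ExtLine.proper l ↔ X ∈ l := Iff.rfl

theorem ideal_mem_proper {d : Quotient (parallelSetoid P L)} {l : L} :
    ExtPoint.ideal d ∈ ExtLine.proper l ↔ d = Quotient.mk (parallelSetoid P L) l := Iff.rfl

theorem proper_notMem_infinity {X : P} :
    (ExtPoint.proper X : ExtPoint P L) ∉ (ExtLine.infinity : ExtLine L) := fun h => h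

theorem ideal_mem_infinity {d : Quotient (parallelSetoid P L)} :
    ExtPoint.ideal d ∈ (ExtLine.infinity : ExtLine L) := trivial

theorem mk_eq_mk {l m : L} :
    Quotient.mk (parallelSetoid P L) l = Quotient.mk (parallelSetoid P L) m ↔ Parallel P L l m :=
  Quotient.eq

theorem eq_of_parallel {l m : L} {X : P} (h : Parallel P L l m) (hl : X ∈ l) (hm : X ∈ m) :
    l = m := h.resolve_right fun h' => h' X hl hm

variable (P L)

theorem exists_parallel (X : P) (g : L) : ∃ l : L, X ∈ l ∧ Parallel P L g l := by
  by_cases h : X ∈ g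
  · exact ⟨g, h, Or.inl rfl⟩
  · obtain ⟨l, hl, -⟩ := AffinePlane.existsUnique_parallel g X h
    exact ⟨l, hl.1, Or.inr hl.2⟩

theorem ext_exists_line (A B : ExtPoint P L) (h : A ≠ B) : ∃ l : ExtLine L, A ∈ l ∧ B ∈ l := by
  rcases A with X | d <;> rcases B with Y | e
  · obtain ⟨l, hX, hY⟩ := AffinePlane.exists_line (L := L) X Y (fun e => h (by rw [e]))
    exact ⟨.proper l, hX, hY⟩
  · induction e using Quotient.ind with | _ g
    obtain ⟨l, hX, hl⟩ := exists_parallel P L X g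
    exact ⟨.proper l, hX, mk_eq_mk.2 hl⟩
  · induction d using Quotient.ind with | _ g
    obtain ⟨l, hY, hl⟩ := exists_parallel P L Y g
    exact ⟨.proper l, mk_eq_mk.2 hl, hY⟩
  · exact ⟨.infinity, trivial, trivial⟩

theorem ext_exists_point (l m : ExtLine L) (hlm : l ≠ m) :
    ∃ A : ExtPoint P L, A ∈ l ∧ A ∈ m := by
  rcases l with l | _ <;> rcases m with m | _
  · by_cases h : Parallel P L l m
    · exact ⟨.ideal (Quotient.mk _ l), rfl, mk_eq_mk.2 h⟩
    · simp only [Parallel, not_or, not_forall, not_not] at h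
      obtain ⟨-, X, hl, hm⟩ := h
      exact ⟨.proper X, hl, hm⟩
  · exact ⟨.ideal (Quotient.mk _ l), rfl, trivial⟩
  · exact ⟨.ideal (Quotient.mk _ m), trivial, rfl⟩
  · exact absurd rfl hlm

theorem ext_eq_or_eq {A B : ExtPoint P L} {l m : ExtLine L} (hAl : A ∈ l) (hBl : B ∈ l)
    (hAm : A ∈ m) (hBm : B ∈ m) : A = B ∨ l = m := by
  rcases A with X | d <;> rcases B with Y | e <;> rcases l with l | _ <;> rcases m with m | _
  · by_cases h : X = Y
    · exact Or.inl (by rw [h])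
    · exact Or.inr (congrArg _ (AffinePlane.line_unique X Y l m h hAl hBl hAm hBm))
  · exact hAm.elim
  · exact hAl.elim
  · exact hAl.elim
  · have h : Parallel P L l m := mk_eq_mk.1 ((ideal_mem_proper.1 hBl).symm.trans hBm)
    exact Or.inr (congrArg _ (eq_of_parallel h hAl hAm))
  · exact hAm.elim
  · exact hAl.elim
  · exact hAl.elim
  · have h : Parallel P L l m := mk_eq_mk.1 ((ideal_mem_proper.1 hAl).symm.trans hAm)
    exact Or.inr (congrArg _ (eq_of_parallel h hBl hBm))
  · exact hBm.elim
  · exact hBl.elim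
  · exact hBl.elim
  · exact Or.inl (congrArg _ ((ideal_mem_proper.1 hAl).trans (ideal_mem_proper.1 hBl).symm))
  · exact Or.inl (congrArg _ ((ideal_mem_proper.1 hAl).trans (ideal_mem_proper.1 hBl).symm))
  · exact Or.inl (congrArg _ ((ideal_mem_proper.1 hAm).trans (ideal_mem_proper.1 hBm).symm))
  · exact Or.inr rfl

theorem ext_exists_config : ∃ (p₁ p₂ p₃ : ExtPoint P L) (l₁ l₂ l₃ : ExtLine L),
    p₁ ∉ l₂ ∧ p₁ ∉ l₃ ∧ p₂ ∉ l₁ ∧ p₂ ∈ l₂ ∧ p₂ ∈ l₃ ∧ p₃ ∉ l₁ ∧ p₃ ∈ l₂ ∧ p₃ ∉ l₃ := by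
  obtain ⟨A, B, C, hAB, hAC, hBC, h⟩ := AffinePlane.exists_noncollinear (P := P) (L := L)
  obtain ⟨a, hBa, hCa⟩ := AffinePlane.exists_line (L := L) B C hBC
  obtain ⟨b, hAb, hCb⟩ := AffinePlane.exists_line (L := L) A C hAC
  obtain ⟨c, hAc, hBc⟩ := AffinePlane.exists_line (L := L) A B hAB
  refine ⟨.ideal (Quotient.mk _ a), .proper A, .proper B, .infinity, .proper c, .proper b,
    fun hac => h ?_, fun hab => h ?_, proper_notMem_infinity, hAc, hAb, proper_notMem_infinity,
    hBc, fun hBb => h ⟨b, hAb, hBb, hCb⟩⟩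
  · rw [← eq_of_parallel (mk_eq_mk.1 hac) hBa hBc] at hAc
    exact ⟨a, hAc, hBa, hCa⟩
  · rw [← eq_of_parallel (mk_eq_mk.1 hab) hCa hCb] at hAb
    exact ⟨a, hAb, hBa, hCa⟩

/-- The extended plane is a projective plane. -/
noncomputable instance instProjectivePlaneExt :
    Configuration.ProjectivePlane (ExtPoint P L) (ExtLine L) where
  exists_point l := by
    obtain ⟨A, B, C, hAB, -, -, h⟩ := AffinePlane.exists_noncollinear (P := P) (L := L)
    rcases l with l | _
    · by_contra! hl
      exact h ⟨l, hl (.proper A), hl (.proper B), hl (.proper C)⟩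
    · exact ⟨.proper A, proper_notMem_infinity⟩
  exists_line A := by
    rcases A with X | d
    · exact ⟨.infinity, proper_notMem_infinity⟩
    · obtain ⟨p₁, p₂, p₃, l₁, l₂, l₃, h₁₂, h₁₃, h₂₁, h₂₂, h₂₃, h₃₁, h₃₂, h₃₃⟩ :=
        ext_exists_config P L
      by_contra! hall
      rcases ext_eq_or_eq P L (hall l₂) h₂₂ (hall l₃) h₂₃ with h | h
      · exact h₂₁ (h ▸ hall l₁)
      · exact h₃₃ (h ▸ h₃₂)
  eq_or_eq := ext_eq_or_eq P L
  mkPoint h := (ext_exists_point P L _ _ h).choose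
  mkPoint_ax h := (ext_exists_point P L _ _ h).choose_spec
  mkLine h := (ext_exists_line P L _ _ h).choose
  mkLine_ax h := (ext_exists_line P L _ _ h).choose_spec
  exists_config := ext_exists_config P L

end Extension

end PappusFundamental

/-!
The second assertion is the first one for the extended plane, so let a projective plane be given.

If the fundamental theorem holds, consider the chain of perspectivities `A₄A₅ → h → A₅A₆` with the
centres `A₁` and `A₃`. On three points it agrees with the perspectivity whose centre is the point
`W = A₃A₄ ∩ A₆A₁`, hence everywhere, and this is Pappus' theorem (`PappusTheorem.of_fundamental`).

Conversely, projectivities with three prescribed pairs exist in every projective plane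
(`exists_projectivity`), and the point is uniqueness: a projectivity of a line onto itself with
three fixed points is the identity. For lines with at most four points this is a matter of counting
(`eq_refl_of_fixed_of_forall_eq`), so let all lines have at least five points.

* Pappus' theorem says that a product of two perspectivities `l → h → m` that fixes `l ∩ m` is a
  perspectivity if `l`, `h`, `m` are not concurrent (`PappusTheorem.isPerspectivity_trans`).
* If `l`, `h`, `m` pass through a point `E`, the product is always a perspectivity
  (`PappusTheorem.isPerspectivity_trans_of_concurrent`). This is Desargues' theorem in another
  guise. It follows from the non-concurrent case when some line through `E`, other than the three
  given ones, avoids both centres. The five points on each line, and so the five lines through `E`,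
  ensure that in a Desargues configuration such a line exists for two of the three centres
  (`PappusTheorem.desargues`).
* Therefore the middle line of a product of two perspectivities can be turned about its
  intersection with one of the outer lines, and every projectivity between distinct lines turns
  out to be a product of two perspectivities (`PappusTheorem.isTwoStep_of_isProjectivity`). If it
  fixes the common point of the two lines, it is a perspectivity by the preceding items.
* Let a projectivity of `l` onto itself have three fixed points, and let `p` be a perspectivity of
  `l` onto another line through one of them. The product of the projectivity and `p` is then a
  perspectivity with the same centre as `p`, so the projectivity is the identity
  (`PappusTheorem.eq_refl_of_fixed`).
-/

namespace PappusFundamental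

open Configuration

section ProjectivePlane

variable {P : Type u} {L : Type v} [Membership P L] [ProjectivePlane P L]

/-! ### Incidence in a projective plane -/

/-- The uniqueness axioms in the form in which `grind` uses them in incidence arguments. -/
theorem line_eq_or_point_eq {X Y : P} {l m : L} (hX : X ∈ l) (hY : Y ∈ l) (hX' : X ∈ m)
    (hY' : Y ∈ m) : l = m ∨ X = Y :=
  (Nondegenerate.eq_or_eq hX hY hX' hY').symm

-- without the guards, the rule would also be instantiated for negated incidences
grind_pattern line_eq_or_point_eq => X ∈ l, Y ∈ l, X ∈ m, Y ∈ m where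
  X =/= Y
  l =/= m
  guard X ∈ l
  guard Y ∈ l
  guard X ∈ m
  guard Y ∈ m

theorem line_eq {X Y : P} {l m : L} (h : X ≠ Y) (hX : X ∈ l) (hY : Y ∈ l) (hX' : X ∈ m)
    (hY' : Y ∈ m) : l = m :=
  (line_eq_or_point_eq hX hY hX' hY').resolve_right h

variable (L) in
theorem exists_join (X Y : P) : ∃ l : L, X ∈ l ∧ Y ∈ l := by
  by_cases h : X = Y
  · subst h
    obtain ⟨p₁, p₂, -, l₁, l₂, -, h₁, -, -, h₂, -⟩ :=
      ProjectivePlane.exists_config (P := P) (L := L)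
    by_cases hX : X = p₁
    · subst hX
      obtain ⟨hl, -⟩ := HasLines.mkLine_ax (L := L) (p₁ := X) (p₂ := p₂) (by grind)
      exact ⟨_, hl, hl⟩
    · obtain ⟨hl, -⟩ := HasLines.mkLine_ax (L := L) hX
      exact ⟨_, hl, hl⟩
  · exact ⟨_, HasLines.mkLine_ax h⟩

variable (P) in
theorem exists_meet (l m : L) : ∃ X : P, X ∈ l ∧ X ∈ m := by
  by_cases h : l = m
  · subst h
    obtain ⟨-, p₂, -, l₁, l₂, -, -, -, h₁, h₂, -⟩ :=
      ProjectivePlane.exists_config (P := P) (L := L)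
    by_cases hl : l = l₁
    · subst hl
      obtain ⟨hX, -⟩ := HasPoints.mkPoint_ax (P := P) (l₁ := l) (l₂ := l₂) (by grind)
      exact ⟨_, hX, hX⟩
    · obtain ⟨hX, -⟩ := HasPoints.mkPoint_ax (P := P) hl
      exact ⟨_, hX, hX⟩
  · exact ⟨_, HasPoints.mkPoint_ax h⟩

omit [ProjectivePlane P L] in
theorem Collin.symm {X Y Z : P} (h : Collin P L X Y Z) : Collin P L X Z Y := by
  obtain ⟨l, h₁, h₂, h₃⟩ := h
  exact ⟨l, h₁, h₃, h₂⟩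

omit [ProjectivePlane P L] in
theorem Collin.swap {X Y Z : P} (h : Collin P L X Y Z) : Collin P L Y X Z := by
  obtain ⟨l, h₁, h₂, h₃⟩ := h
  exact ⟨l, h₂, h₁, h₃⟩

theorem Collin.mem {X Y Z : P} {l : L} (h : Collin P L X Y Z) (hXY : X ≠ Y) (hX : X ∈ l)
    (hY : Y ∈ l) : Z ∈ l := by
  obtain ⟨m, h₁, h₂, h₃⟩ := h
  exact line_eq hXY h₁ h₂ hX hY ▸ h₃

/-! ### Perspectivities with a given centre -/

/-- `f` is the perspectivity from `g` to `h` with centre `S`. -/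
def PerspFrom (S : P) {g h : L} (f : PointsOn P L g ≃ PointsOn P L h) : Prop :=
  S ∉ g ∧ S ∉ h ∧ ∀ X : PointsOn P L g, Collin P L S X.1 (f X).1

theorem exists_perspFrom {S : P} {g h : L} (hg : S ∉ g) (hh : S ∉ h) :
    ∃ f : PointsOn P L g ≃ PointsOn P L h, PerspFrom S f := by
  have key : ∀ X : PointsOn P L g, ∃ Y : PointsOn P L h, Collin P L S X.1 Y.1 := by
    intro X
    obtain ⟨l, h₁, h₂⟩ := exists_join L S X.1
    obtain ⟨Y, h₃, h₄⟩ := exists_meet P l h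
    exact ⟨⟨Y, h₄⟩, l, h₁, h₂, h₃⟩
  choose f hf using key
  refine ⟨Equiv.ofBijective f ⟨?_, ?_⟩, hg, hh, hf⟩
  · rintro ⟨X, hX⟩ ⟨Y, hY⟩ h
    apply Subtype.ext
    obtain ⟨l, h₁, h₂, h₃⟩ := hf ⟨X, hX⟩
    obtain ⟨m, h₁', h₂', h₃'⟩ := hf ⟨Y, hY⟩
    have hZ := (f ⟨Y, hY⟩).2
    rw [h] at h₃
    grind
  · rintro ⟨Y, hY⟩
    obtain ⟨l, h₁, h₂⟩ := exists_join L S Y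
    obtain ⟨X, h₃, h₄⟩ := exists_meet P l g
    obtain ⟨m, h₁', h₂', h₃'⟩ := hf ⟨X, h₄⟩
    have hZ := (f ⟨X, h₄⟩).2
    refine ⟨⟨X, h₄⟩, Subtype.ext ?_⟩
    grind

namespace PerspFrom

variable {S : P} {g h k : L} {f : PointsOn P L g ≃ PointsOn P L h}

omit [ProjectivePlane P L] in
theorem isPerspectivity (hf : PerspFrom S f) : IsPerspectivity f := ⟨S, hf⟩

omit [ProjectivePlane P L] in
theorem symm (hf : PerspFrom S f) : PerspFrom S f.symm :=
  ⟨hf.2.1, hf.1, fun X => by simpa using (hf.2.2 (f.symm X)).symm⟩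

theorem apply_eq (hf : PerspFrom S f) {X : PointsOn P L g} {Y : PointsOn P L h}
    (hXY : Collin P L S X.1 Y.1) : f X = Y := by
  obtain ⟨l, h₁, h₂, h₃⟩ := hXY
  obtain ⟨m, h₁', h₂', h₃'⟩ := hf.2.2 X
  obtain ⟨hg, hh, -⟩ := hf
  have hX := X.2
  have hY := Y.2
  have hZ := (f X).2
  apply Subtype.ext
  grind

theorem apply_self (hf : PerspFrom S f) {X : P} (hg : X ∈ g) (hh : X ∈ h) :
    f ⟨X, hg⟩ = ⟨X, hh⟩ := by
  obtain ⟨l, h₁, h₂⟩ := exists_join L S X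
  exact hf.apply_eq ⟨l, h₁, h₂, h₂⟩

theorem trans (hf : PerspFrom S f) {p : PointsOn P L h ≃ PointsOn P L k} (hp : PerspFrom S p) :
    PerspFrom S (f.trans p) := by
  refine ⟨hf.1, hp.2.1, fun X => ?_⟩
  obtain ⟨l, h₁, h₂, h₃⟩ := hf.2.2 X
  have hS : S ≠ (f X).1 := fun e => hf.2.1 (e ▸ (f X).2)
  exact ⟨l, h₁, h₂, (hp.2.2 (f X)).mem hS h₁ h₃⟩

theorem eq_refl {f : PointsOn P L g ≃ PointsOn P L g} (hf : PerspFrom S f) :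
    f = Equiv.refl _ :=
  Equiv.ext fun X => hf.apply_self X.2 X.2

/-- A perspectivity is determined by its centre. -/
theorem unique (hf : PerspFrom S f) {p : PointsOn P L g ≃ PointsOn P L h} (hp : PerspFrom S p) :
    f = p :=
  Equiv.ext fun X => hf.apply_eq (hp.2.2 X)

end PerspFrom

omit [ProjectivePlane P L] in
theorem IsPerspectivity.symm {g h : L} {f : PointsOn P L g ≃ PointsOn P L h}
    (hf : IsPerspectivity f) : IsPerspectivity f.symm := by
  obtain ⟨S, hS⟩ := hf
  exact ⟨S, PerspFrom.symm hS⟩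

omit [ProjectivePlane P L] in
theorem IsProjectivity.trans {g h k : L} {f : PointsOn P L g ≃ PointsOn P L h}
    {p : PointsOn P L h ≃ PointsOn P L k} (hf : IsProjectivity f) (hp : IsProjectivity p) :
    IsProjectivity (f.trans p) := by
  induction hp with
  | refl => exact hf
  | step _ h₂ ih => exact ih.step h₂

omit [ProjectivePlane P L] in
theorem IsPerspectivity.isProjectivity {g h : L} {f : PointsOn P L g ≃ PointsOn P L h}
    (hf : IsPerspectivity f) : IsProjectivity f :=
  (IsProjectivity.refl g).step hf

omit [ProjectivePlane P L] in
theorem IsProjectivity.symm {g h : L} {f : PointsOn P L g ≃ PointsOn P L h}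
    (hf : IsProjectivity f) : IsProjectivity f.symm := by
  induction hf with
  | refl => exact .refl _
  | step _ h₂ ih => exact h₂.symm.isProjectivity.trans ih

/-! ### Three points on each line -/

variable (P) in
/-- Each line has three points: a third point exists besides any two points. -/
theorem exists_third_point (t : L) (a b : P) : ∃ X : P, X ∈ t ∧ X ≠ a ∧ X ≠ b := by
  obtain ⟨p₁, p₂, p₃, l₁, l₂, l₃, h₁₂, h₁₃, h₂₁, h₂₂, h₂₃, h₃₁, h₃₂, h₃₃⟩ :=
    ProjectivePlane.exists_config (P := P) (L := L)
  obtain ⟨q, hq₁, hq₂⟩ := exists_meet P l₁ l₂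
  -- three points on `t` are obtained from three points of `l₂` by projection from a suitable centre
  have transfer : ∀ S : P, S ∉ l₂ → S ∉ t → ∃ X : P, X ∈ t ∧ X ≠ a ∧ X ≠ b := by
    intro S h₂ ht
    obtain ⟨f, hf⟩ := exists_perspFrom h₂ ht
    have n₁ := f.injective.ne (a₁ := ⟨p₂, h₂₂⟩) (a₂ := ⟨p₃, h₃₂⟩) (by simp; grind)
    have n₂ := f.injective.ne (a₁ := ⟨p₂, h₂₂⟩) (a₂ := ⟨q, hq₂⟩) (by simp; grind)
    have n₃ := f.injective.ne (a₁ := ⟨p₃, h₃₂⟩) (a₂ := ⟨q, hq₂⟩) (by simp; grind)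
    have m₁ := (f ⟨p₂, h₂₂⟩).2
    have m₂ := (f ⟨p₃, h₃₂⟩).2
    have m₃ := (f ⟨q, hq₂⟩).2
    rw [Ne, Subtype.ext_iff] at n₁ n₂ n₃
    grind
  by_cases ht : t = l₂
  · subst ht
    by_cases e₁ : p₂ ≠ a ∧ p₂ ≠ b <;> by_cases e₂ : p₃ ≠ a ∧ p₃ ≠ b <;> grind
  by_cases hp : p₁ ∈ t
  swap
  · exact transfer p₁ h₁₂ hp
  obtain ⟨c, hc₁, hc₂⟩ := exists_meet P t l₂
  -- if `p₁` lies on `t`, the centre is the intersection of the join of a further point `u` of `t`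
  -- and a point `x` of `l₂` with the join of `p₁` and another point `y` of `l₂`
  have hu : ∃ u : P, u ∈ t ∧ u ≠ p₁ ∧ u ≠ c := by
    obtain ⟨u, hu₁, hu₂⟩ := exists_meet P t l₃
    by_cases huc : u = c
    swap
    · exact ⟨u, hu₁, by grind, huc⟩
    obtain ⟨w, hw₁, hw₂⟩ := exists_meet P t l₁
    by_cases hw : w = p₁
    · obtain ⟨y, hy₁, hy₂⟩ := exists_meet P l₁ l₃
      obtain ⟨n, hn₁, hn₂⟩ := exists_join L y p₃
      obtain ⟨v, hv₁, hv₂⟩ := exists_meet P t n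
      refine ⟨v, hv₁, ?_, ?_⟩ <;> grind
    · exact ⟨w, hw₁, hw, by grind⟩
  obtain ⟨u, hu₁, hu₂, hu₃⟩ := hu
  have hxy : ∃ x y : P, x ∈ l₂ ∧ y ∈ l₂ ∧ x ≠ y ∧ x ≠ c ∧ y ≠ c := by
    by_cases e₁ : p₂ = c
    · exact ⟨p₃, q, h₃₂, hq₂, by grind, by grind, by grind⟩
    · by_cases e₂ : p₃ = c
      · exact ⟨p₂, q, h₂₂, hq₂, by grind, by grind, by grind⟩
      · exact ⟨p₂, p₃, h₂₂, h₃₂, by grind, by grind, by grind⟩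
  obtain ⟨x, y, hx, hy, hxy, hxc, hyc⟩ := hxy
  obtain ⟨m, hm₁, hm₂⟩ := exists_join L u x
  obtain ⟨n, hn₁, hn₂⟩ := exists_join L p₁ y
  obtain ⟨S, hS₁, hS₂⟩ := exists_meet P m n
  refine transfer S ?_ ?_ <;> grind

variable (P) in
theorem exists_off_two_lines (g h : L) : ∃ S : P, S ∉ g ∧ S ∉ h := by
  by_cases hgh : g = h
  · obtain ⟨S, hS⟩ := Nondegenerate.exists_point (P := P) g
    exact ⟨S, hS, hgh ▸ hS⟩
  obtain ⟨c, hc₁, hc₂⟩ := exists_meet P g h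
  obtain ⟨x, hx, hxc, -⟩ := exists_third_point P g c c
  obtain ⟨y, hy, hyc, -⟩ := exists_third_point P h c c
  obtain ⟨m, hm₁, hm₂⟩ := exists_join L x y
  obtain ⟨S, hS, hSx, hSy⟩ := exists_third_point P m x y
  exact ⟨S, by grind, by grind⟩

variable (L) in
/-- Each point is on three lines. -/
theorem exists_third_line (E : P) (l m : L) : ∃ t : L, E ∈ t ∧ t ≠ l ∧ t ≠ m := by
  obtain ⟨S, hl, hm⟩ := exists_off_two_lines P l m
  by_cases hE : E ∈ l ∧ E ∈ m
  · obtain ⟨t, ht₁, ht₂⟩ := exists_join L E S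
    exact ⟨t, ht₁, by grind, by grind⟩
  obtain ⟨k, hk⟩ := Nondegenerate.exists_line (L := L) E
  obtain ⟨a, ha₁, ha₂⟩ := exists_meet P k l
  obtain ⟨b, hb₁, hb₂⟩ := exists_meet P k m
  obtain ⟨X, hX, hXa, hXb⟩ := exists_third_point P k a b
  obtain ⟨t, ht₁, ht₂⟩ := exists_join L E X
  exact ⟨t, ht₁, by grind, by grind⟩

/-! ### Pappus' theorem from the fundamental theorem -/

theorem PappusTheorem.of_fundamental (H : FundamentalTheorem P L) : PappusTheorem P L := by
  intro g h A₁ A₂ A₃ A₄ A₅ A₆ U V W hgh a₁ a₃ a₅ b₁ b₃ b₅ a₂ a₄ a₆ b₂ b₄ b₆ h₁₃ h₁₅ h₃₅ h₂₄ h₂₆ h₄₆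
    ⟨s₁₂, c₁₁, c₁₂, c₁⟩ ⟨l, d₁₁, d₁₂, d₁⟩ ⟨s₂₃, c₂₁, c₂₂, c₂⟩ ⟨m, d₂₁, d₂₂, d₂⟩
    ⟨s₃₄, c₃₁, c₃₂, c₃⟩ ⟨s₆₁, d₃₁, d₃₂, d₃⟩
  -- the projectivity `l → h → m` with the centres `A₁` and `A₃` maps `U` to `V`
  obtain ⟨f, hf⟩ := exists_perspFrom (S := A₁) (g := l) (h := h) (by grind) b₁
  obtain ⟨p, hp⟩ := exists_perspFrom (S := A₃) (g := h) (h := m) b₃ (by grind)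
  obtain ⟨Y, hY₁, hY₂⟩ := exists_meet P l s₆₁
  obtain ⟨Z, hZ₁, hZ₂⟩ := exists_meet P m s₃₄
  obtain ⟨O, hO₁, hO₂⟩ := exists_meet P g h
  have hWl : W ∉ l := by grind
  have hWm : W ∉ m := by grind
  obtain ⟨q, hq⟩ := exists_perspFrom hWl hWm
  have hfU : f ⟨U, d₁⟩ = ⟨A₂, a₂⟩ := hf.apply_eq ⟨s₁₂, c₁₁, c₁, c₁₂⟩
  have hpU : p ⟨A₂, a₂⟩ = ⟨V, d₂⟩ := hp.apply_eq ⟨s₂₃, c₂₂, c₂₁, c₂⟩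
  have hf₄ : f ⟨A₄, d₁₁⟩ = ⟨A₄, a₄⟩ := hf.apply_self d₁₁ a₄
  have hp₄ : p ⟨A₄, a₄⟩ = ⟨Z, hZ₁⟩ := hp.apply_eq ⟨s₃₄, c₃₁, c₃₂, hZ₂⟩
  have hq₄ : q ⟨A₄, d₁₁⟩ = ⟨Z, hZ₁⟩ := hq.apply_eq ⟨s₃₄, c₃, c₃₂, hZ₂⟩
  have hf₅ : f ⟨A₅, d₁₂⟩ = ⟨O, hO₂⟩ := hf.apply_eq ⟨g, a₁, a₅, hO₁⟩
  have hp₅ : p ⟨O, hO₂⟩ = ⟨A₅, d₂₁⟩ := hp.apply_eq ⟨g, a₃, hO₁, a₅⟩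
  have hq₅ : q ⟨A₅, d₁₂⟩ = ⟨A₅, d₂₁⟩ := hq.apply_self d₁₂ d₂₁
  have hfY : f ⟨Y, hY₁⟩ = ⟨A₆, a₆⟩ := hf.apply_eq ⟨s₆₁, d₃₂, hY₂, d₃₁⟩
  have hp₆ : p ⟨A₆, a₆⟩ = ⟨A₆, d₂₂⟩ := hp.apply_self a₆ d₂₂
  have hqY : q ⟨Y, hY₁⟩ = ⟨A₆, d₂₂⟩ := hq.apply_eq ⟨s₆₁, d₃, hY₂, d₃₁⟩
  have n₁ : (⟨A₄, d₁₁⟩ : PointsOn P L l) ≠ ⟨A₅, d₁₂⟩ := by simp; grind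
  have n₂ : (⟨A₄, d₁₁⟩ : PointsOn P L l) ≠ ⟨Y, hY₁⟩ := by simp; grind
  have n₃ : (⟨A₅, d₁₂⟩ : PointsOn P L l) ≠ ⟨Y, hY₁⟩ := by simp; grind
  -- it agrees on `A₄`, `A₅` and `Y` with the perspectivity of centre `W`, hence on `U`
  have key : f.trans p = q :=
    (H l m _ _ _ _ _ _ n₁ n₂ n₃ (q.injective.ne n₁) (q.injective.ne n₂) (q.injective.ne n₃)).unique
      ⟨hf.isPerspectivity.isProjectivity.trans hp.isPerspectivity.isProjectivity,
        by simp [hf₄, hp₄, hq₄], by simp [hf₅, hp₅, hq₅], by simp [hfY, hp₆, hqY]⟩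
      ⟨hq.isPerspectivity.isProjectivity, rfl, rfl, rfl⟩
  have hqU : q ⟨U, d₁⟩ = ⟨V, d₂⟩ := by simp [← key, hfU, hpU]
  obtain ⟨t, h₁, h₂, h₃⟩ := hq.2.2 ⟨U, d₁⟩
  rw [hqU] at h₃
  exact ⟨t, h₂, h₃, h₁⟩

/-! ### Existence of projectivities -/

/-- Two triples on distinct lines that share their first point are in perspective. -/
theorem exists_perspectivity_of_common {g h : L} (hgh : g ≠ h) {A B C B' C' : P} (hA : A ∈ g)
    (hB : B ∈ g) (hC : C ∈ g) (hA' : A ∈ h) (hB' : B' ∈ h) (hC' : C' ∈ h) (hAB : A ≠ B)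
    (hAC : A ≠ C) (hBC : B ≠ C) (hAB' : A ≠ B') (hAC' : A ≠ C') (hBC' : B' ≠ C') :
    ∃ f : PointsOn P L g ≃ PointsOn P L h, IsPerspectivity f ∧ f ⟨A, hA⟩ = ⟨A, hA'⟩ ∧
      f ⟨B, hB⟩ = ⟨B', hB'⟩ ∧ f ⟨C, hC⟩ = ⟨C', hC'⟩ := by
  obtain ⟨b, hb₁, hb₂⟩ := exists_join L B B'
  obtain ⟨c, hc₁, hc₂⟩ := exists_join L C C'
  obtain ⟨S, hSb, hSc⟩ := exists_meet P b c
  obtain ⟨f, hf⟩ := exists_perspFrom (S := S) (g := g) (h := h) (by grind) (by grind)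
  exact ⟨f, hf.isPerspectivity, hf.apply_self hA hA', hf.apply_eq ⟨b, hSb, hb₁, hb₂⟩,
    hf.apply_eq ⟨c, hSc, hc₁, hc₂⟩⟩

theorem exists_projectivity {g g' : L} (A B C : PointsOn P L g) (A' B' C' : PointsOn P L g')
    (hAB : A ≠ B) (hAC : A ≠ C) (hBC : B ≠ C) (hAB' : A' ≠ B') (hAC' : A' ≠ C') (hBC' : B' ≠ C') :
    ∃ f : PointsOn P L g ≃ PointsOn P L g',
      IsProjectivity f ∧ f A = A' ∧ f B = B' ∧ f C = C' := by
  -- `g` is first mapped to a line `k` that avoids `A'`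
  obtain ⟨k, hk⟩ := Nondegenerate.exists_line (L := L) A'.1
  obtain ⟨S, hSg, hSk⟩ := exists_off_two_lines P g k
  obtain ⟨f, hf⟩ := exists_perspFrom hSg hSk
  -- and then to a line `h ≠ g'` through `A'` in such a way that the image of `A` goes to `A'`
  obtain ⟨j, hj₁, hj₂⟩ := exists_join L (f A).1 A'.1
  obtain ⟨h, hh₁, hh₂, hh₃⟩ := exists_third_line L A'.1 g' j
  have hfA := (f A).2
  obtain ⟨T, hT₁, hT₂, hT₃⟩ := exists_third_point P j (f A).1 A'.1
  obtain ⟨p, hp⟩ := exists_perspFrom (S := T) (g := k) (h := h) (by grind) (by grind)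
  have hpA : p (f A) = ⟨A'.1, hh₁⟩ := hp.apply_eq ⟨j, hT₁, hj₁, hj₂⟩
  have n₁ := (f.trans p).injective.ne hAB
  have n₂ := (f.trans p).injective.ne hAC
  have n₃ := (f.trans p).injective.ne hBC
  simp only [Equiv.trans_apply, hpA, ne_eq, Subtype.ext_iff] at n₁ n₂ n₃ hAB' hAC' hBC'
  obtain ⟨q, hq, hqA, hqB, hqC⟩ := exists_perspectivity_of_common hh₂ hh₁ (p (f B)).2 (p (f C)).2
    A'.2 B'.2 C'.2 n₁ n₂ n₃ hAB' hAC' hBC'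
  refine ⟨(f.trans p).trans q,
    (hf.isPerspectivity.isProjectivity.step hp.isPerspectivity).step hq, ?_, ?_, ?_⟩
  · simp [hpA, hqA]
  · simpa using hqB
  · simpa using hqC

/-! ### Products of two perspectivities that are perspectivities -/

/-- Pappus' theorem, read as a statement on perspectivities: if the product of two perspectivities
`l → h → m` fixes the point `E = l ∩ m` and `h` does not pass through `E`, then it is a
perspectivity. The hexagon has the centres and `E` on one line, and on `h` the points `l ∩ h`,
`m ∩ h` and the image of a variable point of `l`. -/
theorem PappusTheorem.isPerspectivity_trans (H : PappusTheorem P L) {l h m : L}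
    {f : PointsOn P L l ≃ PointsOn P L h} {p : PointsOn P L h ≃ PointsOn P L m}
    (hf : IsPerspectivity f) (hp : IsPerspectivity p) (hlm : l ≠ m) {E : P} (hEl : E ∈ l)
    (hEm : E ∈ m) (hEh : E ∉ h) (hE : p (f ⟨E, hEl⟩) = ⟨E, hEm⟩) :
    IsPerspectivity (f.trans p) := by
  obtain ⟨A, hf⟩ : ∃ A, PerspFrom A f := hf
  obtain ⟨B, hp⟩ : ∃ B, PerspFrom B p := hp
  by_cases hAB : A = B
  · subst hAB
    exact (hf.trans hp).isPerspectivity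
  obtain ⟨g, hAg, hEg, hOg⟩ := hf.2.2 ⟨E, hEl⟩
  have hBO := hp.2.2 (f ⟨E, hEl⟩)
  rw [hE] at hBO
  generalize f ⟨E, hEl⟩ = O at hOg hBO hE
  obtain ⟨O, hOh⟩ := O
  dsimp only at *
  obtain ⟨g', hBg, hOg', hEg'⟩ := hBO
  obtain rfl : g = g' := by grind
  obtain ⟨A₄, h₄l, h₄h⟩ := exists_meet P l h
  obtain ⟨A₆, h₆m, h₆h⟩ := exists_meet P m h
  obtain ⟨s, hs₁, hs₂⟩ := exists_join L B A₄
  obtain ⟨t, ht₁, ht₂⟩ := exists_join L A₆ A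
  obtain ⟨W, hWs, hWt⟩ := exists_meet P s t
  have hAl := hf.1
  have hAh := hf.2.1
  have hBh := hp.1
  have hBm := hp.2.1
  refine ⟨W, by grind, by grind, fun X => ?_⟩
  obtain ⟨x, hx₁, hx₂, hx₃⟩ := hf.2.2 X
  obtain ⟨v, hv₁, hv₂, hv₃⟩ := hp.2.2 (f X)
  have hVm := (p (f X)).2
  have hA₂ := (f X).2
  have hXl := X.2
  simp only [Equiv.trans_apply]
  generalize (p (f X)).1 = V at hv₃ hVm ⊢
  generalize (f X).1 = A₂ at hx₃ hv₂ hA₂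
  generalize X.1 = X at hx₂ hXl ⊢
  by_cases e₄ : A₂ = A₄
  · subst e₄
    refine ⟨s, hWs, ?_, ?_⟩ <;> grind
  by_cases e₆ : A₂ = A₆
  · subst e₆
    refine ⟨t, hWt, ?_, ?_⟩ <;> grind
  by_cases eO : A₂ = O
  · obtain ⟨w, hw₁, hw₂⟩ := exists_join L W E
    refine ⟨w, hw₁, ?_, ?_⟩ <;> grind
  obtain ⟨r, hr₁, hr₂, hr₃⟩ := H g h A A₂ B A₄ E A₆ X V W (by grind) hAg hBg hEg hAh hBh hEh hA₂ h₄h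
    h₆h (by grind) (by grind) (by grind) hAB (by grind) (by grind) e₄ e₆ (by grind)
    ⟨x, hx₁, hx₃, hx₂⟩ ⟨l, h₄l, hEl, hXl⟩
    ⟨v, hv₂, hv₁, hv₃⟩ ⟨m, hEm, h₆m, hVm⟩ ⟨s, hs₁, hs₂, hWs⟩ ⟨t, ht₁, ht₂, hWt⟩
  exact ⟨r, hr₃, hr₁, hr₂⟩

/-! ### Desargues' theorem from Pappus' theorem -/

/-- The product of two perspectivities `l → h → m` between lines through a point `E` is a
perspectivity, provided that there is a further line `e` through `E` that contains neither of the
centres `A`, `B`. For a point `D` of `e` and a suitable line `k` not through `E`, both `l → h → k`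
and `k → h → m`, where `D` is the centre between `h` and `k`, are perspectivities by Pappus'
theorem, and so is then their product `l → k → m`. -/
theorem PappusTheorem.isPerspectivity_trans_of_free_line (H : PappusTheorem P L) {l h m e : L}
    {E A B : P} {f : PointsOn P L l ≃ PointsOn P L h} {p : PointsOn P L h ≃ PointsOn P L m}
    (hf : PerspFrom A f) (hp : PerspFrom B p) (hlh : l ≠ h) (hhm : h ≠ m) (hlm : l ≠ m)
    (hEl : E ∈ l) (hEh : E ∈ h) (hEm : E ∈ m) (hEe : E ∈ e) (hel : e ≠ l) (heh : e ≠ h)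
    (hem : e ≠ m) (hAe : A ∉ e) (hBe : B ∉ e) : IsPerspectivity (f.trans p) := by
  obtain ⟨c, hc₁, hc₂⟩ := exists_join L A B
  obtain ⟨Q, hQ₁, hQ₂⟩ := exists_meet P e c
  obtain ⟨D, hDe, hDE, hDQ⟩ := exists_third_point P e E Q
  by_cases hAB : A = B
  · subst hAB
    exact (hf.trans hp).isPerspectivity
  have hDc : D ∉ c := by grind
  obtain ⟨a, ha₁, ha₂⟩ := exists_join L D A
  obtain ⟨b, hb₁, hb₂⟩ := exists_join L D B
  obtain ⟨X, hXa, hXl⟩ := exists_meet P a l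
  obtain ⟨Y, hYb, hYm⟩ := exists_meet P b m
  obtain ⟨k, hk₁, hk₂⟩ := exists_join L X Y
  have hDk : D ∉ k := by grind
  have hDh : D ∉ h := by grind
  have hXE : X ≠ E := by grind
  have hYE : Y ≠ E := by grind
  have hEk : E ∉ k := by grind
  have hAl := hf.1
  have hBm := hp.2.1
  obtain ⟨d, hd⟩ := exists_perspFrom hDh hDk
  have h₁ : IsPerspectivity (f.trans d) := by
    refine H.isPerspectivity_trans hf.isPerspectivity hd.isPerspectivity (by grind) hXl hk₁
      (by grind) (hd.apply_eq ?_)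
    obtain ⟨r, hr₁, hr₂, hr₃⟩ := hf.2.2 ⟨X, hXl⟩
    exact ⟨a, ha₁, by grind, hXa⟩
  have h₂ : IsPerspectivity (d.symm.trans p) := by
    refine H.isPerspectivity_trans hd.symm.isPerspectivity hp.isPerspectivity (by grind) hk₂ hYm
      (by grind) (hp.apply_eq ?_)
    obtain ⟨r, hr₁, hr₂, hr₃⟩ := hd.symm.2.2 ⟨Y, hk₂⟩
    exact ⟨b, hb₂, by grind, hYb⟩
  have h₃ := H.isPerspectivity_trans h₁ h₂ hlm hEl hEm hEk
    (by simp [hf.apply_self hEl hEh, hp.apply_self hEh hEm])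
  convert h₃ using 1
  ext X
  simp

/-- The line `c` of the centres `A` and `B` meets `l` and `m` in corresponding points. If `c` does
not pass through `l ∩ m`, these are distinct, and so `c` contains the centre of the product. -/
theorem PerspFrom.collin_of_notMem {l h m c : L} {E A B F : P}
    {f : PointsOn P L l ≃ PointsOn P L h} {p : PointsOn P L h ≃ PointsOn P L m}
    (hf : PerspFrom A f) (hp : PerspFrom B p) (hq : PerspFrom F (f.trans p)) (hlm : l ≠ m)
    (hEl : E ∈ l) (hEm : E ∈ m) (hAc : A ∈ c) (hBc : B ∈ c) (hEc : E ∉ c) : F ∈ c := by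
  obtain ⟨X, hXc, hXl⟩ := exists_meet P c l
  obtain ⟨r, hr₁, hr₂, hr₃⟩ := hf.2.2 ⟨X, hXl⟩
  obtain ⟨s, hs₁, hs₂, hs₃⟩ := hp.2.2 (f ⟨X, hXl⟩)
  obtain ⟨t, ht₁, ht₂, ht₃⟩ := hq.2.2 ⟨X, hXl⟩
  rw [Equiv.trans_apply] at ht₃
  have hA := hf.1
  have hB := hp.1
  have h₁ := (f ⟨X, hXl⟩).2
  have h₂ := (p (f ⟨X, hXl⟩)).2
  grind

/-- If the product of two perspectivities between three lines through a point is a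
perspectivity, then the three centres are collinear. -/
theorem PerspFrom.collin {l h m : L} {E A B F : P}
    {f : PointsOn P L l ≃ PointsOn P L h} {p : PointsOn P L h ≃ PointsOn P L m}
    (hf : PerspFrom A f) (hp : PerspFrom B p) (hq : PerspFrom F (f.trans p)) (hlm : l ≠ m)
    (hhm : h ≠ m) (hEl : E ∈ l) (hEh : E ∈ h) (hEm : E ∈ m) : Collin P L A B F := by
  obtain ⟨c, hA, hB⟩ := exists_join L A B
  obtain ⟨d, hA', hF⟩ := exists_join L A F
  by_cases hc : E ∈ c
  · by_cases hd : E ∈ d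
    · have := hf.1
      exact ⟨c, hA, hB, by grind⟩
    · have hp' : PerspFrom B (f.symm.trans (f.trans p)) := by
        rw [← Equiv.trans_assoc]
        simpa using hp
      exact ⟨d, hA', hf.symm.collin_of_notMem hq hp' hhm hEh hEm hA' hF hd, hF⟩
  · exact ⟨c, hA, hB, hf.collin_of_notMem hp hq hlm hEl hEm hA hB hc⟩

/-- Desargues' theorem, under the assumption that a further line through the centre `E` avoids
two of the three points whose collinearity is asserted. -/
theorem PappusTheorem.desargues_of_free_line (H : PappusTheorem P L) {l₁ l₂ l₃ e : L}
    {E X₁ X₂ X₃ Y₁ Y₂ Y₃ A₁₂ A₂₃ A₁₃ : P} (h₁₂ : l₁ ≠ l₂) (h₂₃ : l₂ ≠ l₃) (h₁₃ : l₁ ≠ l₃)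
    (hE₁ : E ∈ l₁) (hE₂ : E ∈ l₂) (hE₃ : E ∈ l₃) (hX₁ : X₁ ∈ l₁) (hX₂ : X₂ ∈ l₂) (hX₃ : X₃ ∈ l₃)
    (hY₁ : Y₁ ∈ l₁) (hY₂ : Y₂ ∈ l₂) (hY₃ : Y₃ ∈ l₃) (hEX₁ : X₁ ≠ E) (hEX₂ : X₂ ≠ E)
    (hEX₃ : X₃ ≠ E) (hEY₁ : Y₁ ≠ E) (hEY₂ : Y₂ ≠ E) (hEY₃ : Y₃ ≠ E) (hXY₁ : X₁ ≠ Y₁)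
    (hXY₂ : X₂ ≠ Y₂) (hXY₃ : X₃ ≠ Y₃) (hA₁₂ : Collin P L X₁ X₂ A₁₂) (hA₁₂' : Collin P L Y₁ Y₂ A₁₂)
    (hA₂₃ : Collin P L X₂ X₃ A₂₃) (hA₂₃' : Collin P L Y₂ Y₃ A₂₃) (hA₁₃ : Collin P L X₁ X₃ A₁₃)
    (hA₁₃' : Collin P L Y₁ Y₃ A₁₃) (hEe : E ∈ e) (he₁ : e ≠ l₁) (he₂ : e ≠ l₂) (he₃ : e ≠ l₃)
    (he₁₃ : A₁₃ ∉ e) (he₂₃ : A₂₃ ∉ e) : Collin P L A₁₂ A₂₃ A₁₃ := by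
  obtain ⟨a, ha₁, ha₂, ha₃⟩ := hA₁₂
  obtain ⟨a', ha₁', ha₂', ha₃'⟩ := hA₁₂'
  obtain ⟨b, hb₁, hb₂, hb₃⟩ := hA₂₃
  obtain ⟨b', hb₁', hb₂', hb₃'⟩ := hA₂₃'
  obtain ⟨c, hc₁, hc₂, hc₃⟩ := hA₁₃
  obtain ⟨c', hc₁', hc₂', hc₃'⟩ := hA₁₃'
  obtain ⟨f, hf⟩ := exists_perspFrom (S := A₁₃) (g := l₁) (h := l₃) (by grind) (by grind)
  obtain ⟨p, hp⟩ := exists_perspFrom (S := A₂₃) (g := l₃) (h := l₂) (by grind) (by grind)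
  obtain ⟨F, hF⟩ : ∃ F, PerspFrom F (f.trans p) :=
    H.isPerspectivity_trans_of_free_line hf hp h₁₃ h₂₃.symm h₁₂ hE₁ hE₃ hE₂ hEe he₁ he₃
      he₂ he₁₃ he₂₃
  have hfX : f ⟨X₁, hX₁⟩ = ⟨X₃, hX₃⟩ := hf.apply_eq ⟨c, hc₃, hc₁, hc₂⟩
  have hfY : f ⟨Y₁, hY₁⟩ = ⟨Y₃, hY₃⟩ := hf.apply_eq ⟨c', hc₃', hc₁', hc₂'⟩
  have hpX : p ⟨X₃, hX₃⟩ = ⟨X₂, hX₂⟩ := hp.apply_eq ⟨b, hb₃, hb₂, hb₁⟩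
  have hpY : p ⟨Y₃, hY₃⟩ = ⟨Y₂, hY₂⟩ := hp.apply_eq ⟨b', hb₃', hb₂', hb₁'⟩
  obtain ⟨x, hx₁, hx₂, hx₃⟩ := hF.2.2 ⟨X₁, hX₁⟩
  obtain ⟨y, hy₁, hy₂, hy₃⟩ := hF.2.2 ⟨Y₁, hY₁⟩
  simp only [Equiv.trans_apply, hfX, hpX, hfY, hpY] at hx₃ hy₃
  obtain rfl : F = A₁₂ := by grind
  obtain ⟨r, hr₁, hr₂, hr₃⟩ := hf.collin hp hF h₁₂ h₂₃.symm hE₁ hE₃ hE₂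
  exact ⟨r, hr₃, hr₂, hr₁⟩

variable (P L) in
/-- Each line has at least five points: besides any four points there is a fifth. -/
def FivePoints : Prop := ∀ (l : L) (a b c d : P), ∃ X : P, X ∈ l ∧ X ≠ a ∧ X ≠ b ∧ X ≠ c ∧ X ≠ d

theorem FivePoints.exists_line (R : FivePoints P L) (E : P) (a b c d : L) :
    ∃ t : L, E ∈ t ∧ t ≠ a ∧ t ≠ b ∧ t ≠ c ∧ t ≠ d := by
  obtain ⟨k, hk⟩ := Nondegenerate.exists_line (L := L) E
  have key : ∀ l : L, ∃ Y : P, E ∈ l → Y ∈ k ∧ Y ∈ l := fun l =>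
    (exists_meet P k l).imp fun _ h _ => h
  obtain ⟨A, hA⟩ := key a
  obtain ⟨B, hB⟩ := key b
  obtain ⟨C, hC⟩ := key c
  obtain ⟨D, hD⟩ := key d
  obtain ⟨X, hX, h₁, h₂, h₃, h₄⟩ := R k A B C D
  obtain ⟨t, ht₁, ht₂⟩ := exists_join L E X
  exact ⟨t, ht₁, by grind, by grind, by grind, by grind⟩

/-- Desargues' theorem for two triangles in perspective from `E`. If the line of `E` and `A₁₂` is
not among the lines `l₁`, `l₂`, `l₃`, `EA₂₃`, `EA₁₃`, it is free for the pair `A₁₃`, `A₂₃`.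
Otherwise, for a suitable second point among the three, the lines `l₁`, `l₂`, `l₃` and the joins of
`E` with `A₁₂` and this point are at most four lines, and a fifth line is free for this pair. -/
theorem PappusTheorem.desargues (H : PappusTheorem P L) (R : FivePoints P L) {l₁ l₂ l₃ : L}
    {E X₁ X₂ X₃ Y₁ Y₂ Y₃ A₁₂ A₂₃ A₁₃ : P} (h₁₂ : l₁ ≠ l₂) (h₂₃ : l₂ ≠ l₃) (h₁₃ : l₁ ≠ l₃)
    (hE₁ : E ∈ l₁) (hE₂ : E ∈ l₂) (hE₃ : E ∈ l₃) (hX₁ : X₁ ∈ l₁) (hX₂ : X₂ ∈ l₂) (hX₃ : X₃ ∈ l₃)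
    (hY₁ : Y₁ ∈ l₁) (hY₂ : Y₂ ∈ l₂) (hY₃ : Y₃ ∈ l₃) (hEX₁ : X₁ ≠ E) (hEX₂ : X₂ ≠ E)
    (hEX₃ : X₃ ≠ E) (hEY₁ : Y₁ ≠ E) (hEY₂ : Y₂ ≠ E) (hEY₃ : Y₃ ≠ E) (hXY₁ : X₁ ≠ Y₁)
    (hXY₂ : X₂ ≠ Y₂) (hXY₃ : X₃ ≠ Y₃) (hA₁₂ : Collin P L X₁ X₂ A₁₂) (hA₁₂' : Collin P L Y₁ Y₂ A₁₂)
    (hA₂₃ : Collin P L X₂ X₃ A₂₃) (hA₂₃' : Collin P L Y₂ Y₃ A₂₃) (hA₁₃ : Collin P L X₁ X₃ A₁₃)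
    (hA₁₃' : Collin P L Y₁ Y₃ A₁₃) : Collin P L A₁₂ A₂₃ A₁₃ := by
  obtain ⟨a, ha₁, ha₂⟩ := exists_join L E A₁₂
  obtain ⟨b, hb₁, hb₂⟩ := exists_join L E A₂₃
  obtain ⟨c, hc₁, hc₂⟩ := exists_join L E A₁₃
  have ne_of : ∀ {X X' Y Y' A : P} {l l' : L}, l ≠ l' → E ∈ l → E ∈ l' → X ∈ l → X' ∈ l' → Y ∈ l →
      Y' ∈ l' → X ≠ E → X' ≠ E → Y ≠ E → Y' ≠ E → X ≠ Y → X' ≠ Y' → Collin P L X X' A →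
      Collin P L Y Y' A → A ≠ E := by
    rintro X X' Y Y' A l l' _ _ _ _ _ _ _ _ _ _ _ _ _ ⟨s, hs₁, hs₂, hs₃⟩ ⟨t, ht₁, ht₂, ht₃⟩
    grind
  have hA := ne_of h₁₂ hE₁ hE₂ hX₁ hX₂ hY₁ hY₂ hEX₁ hEX₂ hEY₁ hEY₂ hXY₁ hXY₂ hA₁₂ hA₁₂'
  have hB := ne_of h₂₃ hE₂ hE₃ hX₂ hX₃ hY₂ hY₃ hEX₂ hEX₃ hEY₂ hEY₃ hXY₂ hXY₃ hA₂₃ hA₂₃'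
  have hC := ne_of h₁₃ hE₁ hE₃ hX₁ hX₃ hY₁ hY₃ hEX₁ hEX₃ hEY₁ hEY₃ hXY₁ hXY₃ hA₁₃ hA₁₃'
  by_cases hfree : a ≠ l₁ ∧ a ≠ l₂ ∧ a ≠ l₃ ∧ a ≠ b ∧ a ≠ c
  · exact H.desargues_of_free_line h₁₂ h₂₃ h₁₃ hE₁ hE₂ hE₃ hX₁ hX₂ hX₃ hY₁ hY₂ hY₃ hEX₁ hEX₂ hEX₃
      hEY₁ hEY₂ hEY₃ hXY₁ hXY₂ hXY₃ hA₁₂ hA₁₂' hA₂₃ hA₂₃' hA₁₃ hA₁₃' ha₁ hfree.1 hfree.2.1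
      hfree.2.2.1 (by grind) (by grind)
  by_cases hac : a = c
  · obtain ⟨e, he, he₁, he₂, he₃, hec⟩ := R.exists_line E l₁ l₂ l₃ c
    exact (H.desargues_of_free_line h₂₃ h₁₃.symm h₁₂.symm hE₂ hE₃ hE₁ hX₂ hX₃ hX₁ hY₂ hY₃ hY₁ hEX₂
      hEX₃ hEX₁ hEY₂ hEY₃ hEY₁ hXY₂ hXY₃ hXY₁ hA₂₃ hA₂₃' hA₁₃.swap hA₁₃'.swap hA₁₂.swap hA₁₂'.swap
      he he₂ he₃ he₁ (by grind) (by grind)).symm.swap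
  · obtain ⟨e, he, he₁, he₂, he₃, heb⟩ := R.exists_line E l₁ l₂ l₃ b
    exact (H.desargues_of_free_line h₁₃ h₂₃.symm h₁₂ hE₁ hE₃ hE₂ hX₁ hX₃ hX₂ hY₁ hY₃ hY₂ hEX₁
      hEX₃ hEX₂ hEY₁ hEY₃ hEY₂ hXY₁ hXY₃ hXY₂ hA₁₃ hA₁₃' hA₂₃.swap hA₂₃'.swap hA₁₂ hA₁₂'
      he he₁ he₃ he₂ (by grind) (by grind)).symm.swap.symm

/-- The product of two perspectivities `l → h → m` between lines through a point is a
perspectivity, provided that `l ≠ m`. -/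
theorem PappusTheorem.isPerspectivity_trans_of_concurrent (H : PappusTheorem P L)
    (R : FivePoints P L) {l h m : L} {E : P} {f : PointsOn P L l ≃ PointsOn P L h}
    {p : PointsOn P L h ≃ PointsOn P L m} (hf : IsPerspectivity f) (hp : IsPerspectivity p)
    (hlm : l ≠ m) (hEl : E ∈ l) (hEh : E ∈ h) (hEm : E ∈ m) : IsPerspectivity (f.trans p) := by
  obtain ⟨A, hA⟩ : ∃ A, PerspFrom A f := hf
  obtain ⟨B, hB⟩ : ∃ B, PerspFrom B p := hp
  by_cases hlh : l = h
  · subst hlh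
    simpa [hA.eq_refl] using hB.isPerspectivity
  by_cases hhm : h = m
  · subst hhm
    simpa [hB.eq_refl] using hA.isPerspectivity
  by_cases hAB : A = B
  · subst hAB
    exact (hA.trans hB).isPerspectivity
  obtain ⟨c, hAc, hBc⟩ := exists_join L A B
  obtain ⟨Q, hQc, hQl⟩ := exists_meet P c l
  -- a point `Y` off the line of the centres, and the trace `F` of the line of `Y` and its image:
  -- by Desargues' theorem the line of any other point and its image passes through `F`
  obtain ⟨Y, hYl, hYE, hYQ⟩ := exists_third_point P l E Q
  have hAl := hA.1
  have hAh := hA.2.1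
  have hBh := hB.1
  have hBm := hB.2.1
  obtain ⟨s, hs₁, hs₂, hs₃⟩ := hA.2.2 ⟨Y, hYl⟩
  obtain ⟨t, ht₁, ht₂, ht₃⟩ := hB.2.2 (f ⟨Y, hYl⟩)
  have hY₁ := (f ⟨Y, hYl⟩).2
  have hY₂ := (p (f ⟨Y, hYl⟩)).2
  have hYc : Y ∉ c := by grind
  have key : ∀ X : PointsOn P L l, X.1 ≠ Y → X.1 ≠ E → (f X).1 ≠ (f ⟨Y, hYl⟩).1 ∧
      (p (f X)).1 ≠ (p (f ⟨Y, hYl⟩)).1 := fun X hX _ =>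
    ⟨fun e => hX (congrArg Subtype.val (f.injective (Subtype.ext e))),
      fun e => hX (congrArg Subtype.val (f.injective (p.injective (Subtype.ext e))))⟩
  generalize (p (f ⟨Y, hYl⟩)).1 = Y₂ at *
  generalize (f ⟨Y, hYl⟩).1 = Y₁ at *
  obtain ⟨y, hy₁, hy₂⟩ := exists_join L Y Y₂
  obtain ⟨F, hFc, hFy⟩ := exists_meet P c y
  refine ⟨F, by grind, by grind, fun X => ?_⟩
  obtain ⟨a, ha₁, ha₂, ha₃⟩ := hA.2.2 X
  obtain ⟨b, hb₁, hb₂, hb₃⟩ := hB.2.2 (f X)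
  have hX := X.2
  have hX₁ := (f X).2
  have hX₂ := (p (f X)).2
  specialize key X
  rw [Equiv.trans_apply]
  generalize (p (f X)).1 = X₂ at *
  generalize (f X).1 = X₁ at *
  generalize X.1 = X at *
  by_cases hXE : X = E
  · obtain ⟨r, hr₁, hr₂⟩ := exists_join L F E
    exact ⟨r, hr₁, by grind, by grind⟩
  by_cases hXY : X = Y
  · exact ⟨y, hFy, by grind, by grind⟩
  obtain ⟨x, hx₁, hx₂⟩ := exists_join L X X₂
  obtain ⟨G, hGx, hGy⟩ := exists_meet P x y
  obtain ⟨n₁, n₂⟩ := key hXY hXE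
  obtain ⟨r, hr₁, hr₂, hr₃⟩ := H.desargues R hlh hhm hlm hEl hEh hEm hX hX₁ hX₂ hYl hY₁ hY₂ hXE
    (by grind) (by grind) hYE (by grind) (by grind) hXY n₁ n₂ ⟨a, ha₂, ha₃, ha₁⟩ ⟨s, hs₂, hs₃, hs₁⟩
    ⟨b, hb₂, hb₃, hb₁⟩ ⟨t, ht₂, ht₃, ht₁⟩ ⟨x, hx₁, hx₂, hGx⟩ ⟨y, hy₁, hy₂, hGy⟩
  exact ⟨x, by grind, hx₁, hx₂⟩

/-! ### Shortening chains of perspectivities -/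

/-- `f` is a product of two perspectivities. -/
def IsTwoStep {l n : L} (f : PointsOn P L l ≃ PointsOn P L n) : Prop :=
  ∃ (h : L) (a : PointsOn P L l ≃ PointsOn P L h) (b : PointsOn P L h ≃ PointsOn P L n),
    IsPerspectivity a ∧ IsPerspectivity b ∧ a.trans b = f

theorem isPerspectivity_refl (l : L) : IsPerspectivity (Equiv.refl (PointsOn P L l)) := by
  obtain ⟨S, hS⟩ := Nondegenerate.exists_point (P := P) l
  obtain ⟨f, hf⟩ := exists_perspFrom hS hS
  exact hf.eq_refl ▸ hf.isPerspectivity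

theorem IsPerspectivity.isTwoStep {l n : L} {f : PointsOn P L l ≃ PointsOn P L n}
    (hf : IsPerspectivity f) : IsTwoStep f :=
  ⟨n, f, Equiv.refl _, hf, isPerspectivity_refl n, Equiv.trans_refl f⟩

omit [ProjectivePlane P L] in
theorem IsTwoStep.symm {l n : L} {f : PointsOn P L l ≃ PointsOn P L n} (hf : IsTwoStep f) :
    IsTwoStep f.symm := by
  obtain ⟨h, a, b, ha, hb, rfl⟩ := hf
  exact ⟨h, b.symm, a.symm, hb.symm, ha.symm, rfl⟩

theorem IsPerspectivity.eq_refl {l : L} {f : PointsOn P L l ≃ PointsOn P L l}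
    (hf : IsPerspectivity f) : f = Equiv.refl _ := by
  obtain ⟨S, hS⟩ : ∃ S, PerspFrom S f := hf
  exact hS.eq_refl

/-- A chain `l → h → k → n` can be shortened if `l`, `k`, `n` are not concurrent. The line `h` is
turned about `h ∩ k`, and then about its new intersection with `l`, until it passes through
`k ∩ n`. In each turn the perspectivities on both sides of `h` remain perspectivities, because
they are changed by perspectivities between lines through the centre of the turn; after the second
turn the last two perspectivities are between lines through `k ∩ n` and can be merged. -/
theorem PappusTheorem.isTwoStep_of_not_concurrent (H : PappusTheorem P L) (R : FivePoints P L)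
    {l h k n : L} {a : PointsOn P L l ≃ PointsOn P L h} {b : PointsOn P L h ≃ PointsOn P L k}
    {c : PointsOn P L k ≃ PointsOn P L n} (ha : IsPerspectivity a) (hb : IsPerspectivity b)
    (hc : IsPerspectivity c) (hlk : l ≠ k) {O : P} (hOl : O ∈ l) (hOk : O ∈ k) (hOn : O ∉ n) :
    IsTwoStep ((a.trans b).trans c) := by
  by_cases hOh : O ∈ h
  · exact ⟨k, _, _, H.isPerspectivity_trans_of_concurrent R ha hb hlk hOl hOh hOk, hc, rfl⟩
  obtain ⟨A, hA⟩ : ∃ A, PerspFrom A a := ha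
  have hAl := hA.1
  have hAh := hA.2.1
  obtain ⟨K, hKh, hKk⟩ := exists_meet P h k
  obtain ⟨N, hNk, hNn⟩ := exists_meet P k n
  obtain ⟨M, hMl, hMn⟩ := exists_meet P l n
  obtain ⟨j, hAj, hKj⟩ := exists_join L A K
  obtain ⟨T, hTj, hTl⟩ := exists_meet P j l
  -- the new intersection `X` with `l` is not mapped to `N`, so that the centre of the second
  -- perspectivity does not obstruct the second turn
  obtain ⟨X, hXl, hXO, hXT, hXM, hXN⟩ := R l O T M ((a.trans b).symm ⟨N, hNk⟩).1
  obtain ⟨h₁, hX₁, hK₁⟩ := exists_join L X K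
  obtain ⟨a₁, ha₁⟩ := exists_perspFrom (S := A) (g := l) (h := h₁) hAl (by grind)
  obtain ⟨a₂, ha₂⟩ := exists_perspFrom (S := A) (g := h₁) (h := h) ha₁.2.1 hAh
  obtain rfl : a₁.trans a₂ = a := (ha₁.trans ha₂).unique hA
  obtain ⟨B, hB⟩ : ∃ B, PerspFrom B (a₂.trans b) :=
    H.isPerspectivity_trans_of_concurrent R ha₂.isPerspectivity hb (by grind) hK₁ hKh hKk
  obtain ⟨h₂, hX₂, hN₂⟩ := exists_join L X N
  have hBh₂ : B ∉ h₂ := by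
    intro hBh₂
    have h₁ : (a₂.trans b) ⟨X, hX₁⟩ = ⟨N, hNk⟩ := hB.apply_eq ⟨h₂, hBh₂, hX₂, hN₂⟩
    have h₂ : a₁ ⟨X, hXl⟩ = ⟨X, hX₁⟩ := ha₁.apply_self hXl hX₁
    refine hXN (congrArg Subtype.val ((Equiv.eq_symm_apply _).2 ?_ : ⟨X, hXl⟩ = _))
    rw [← h₁, ← h₂]
    rfl
  obtain ⟨b₁, hb₁⟩ := exists_perspFrom hB.1 hBh₂
  obtain ⟨b₂, hb₂⟩ := exists_perspFrom hBh₂ hB.2.1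
  have e : b₁.trans b₂ = a₂.trans b := (hb₁.trans hb₂).unique hB
  refine ⟨h₂, a₁.trans b₁, b₂.trans c, ?_, ?_, ?_⟩
  · exact H.isPerspectivity_trans_of_concurrent R ha₁.isPerspectivity hb₁.isPerspectivity
      (by grind) hXl hX₁ hX₂
  · exact H.isPerspectivity_trans_of_concurrent R hb₂.isPerspectivity hc (by grind) hN₂ hNk hNn
  · rw [show (a₁.trans a₂).trans b = a₁.trans (a₂.trans b) from rfl, ← e]
    rfl

/-- The mirror image of `PappusTheorem.isTwoStep_of_not_concurrent`, for the lines `l`, `h`, `n`. -/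
theorem PappusTheorem.isTwoStep_of_not_concurrent' (H : PappusTheorem P L) (R : FivePoints P L)
    {l h k n : L} {a : PointsOn P L l ≃ PointsOn P L h} {b : PointsOn P L h ≃ PointsOn P L k}
    {c : PointsOn P L k ≃ PointsOn P L n} (ha : IsPerspectivity a) (hb : IsPerspectivity b)
    (hc : IsPerspectivity c) (hhn : h ≠ n) {O : P} (hOn : O ∈ n) (hOh : O ∈ h) (hOl : O ∉ l) :
    IsTwoStep ((a.trans b).trans c) :=
  (H.isTwoStep_of_not_concurrent R hc.symm hb.symm ha.symm hhn.symm hOn hOh hOl).symm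

/-- A product of three perspectivities between distinct lines is a product of two. -/
theorem PappusTheorem.isTwoStep_trans (H : PappusTheorem P L) (R : FivePoints P L) {l k n : L}
    {f : PointsOn P L l ≃ PointsOn P L k} {c : PointsOn P L k ≃ PointsOn P L n} (hf : IsTwoStep f)
    (hc : IsPerspectivity c) (hln : l ≠ n) : IsTwoStep (f.trans c) := by
  obtain ⟨h, a, b, ha, hb, rfl⟩ := hf
  by_cases hlk : l = k
  · subst hlk
    by_cases hhn : h = n
    · subst hhn
      -- a chain `l → h → l → h`: a third line `j` through `l ∩ h` is inserted into `h → l`, so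
      -- that both halves of `l → h → j → l → h` can be merged
      obtain ⟨B, hB⟩ : ∃ B, PerspFrom B b := hb
      obtain ⟨O, hOl, hOh⟩ := exists_meet P l h
      obtain ⟨i, hOi, hBi⟩ := exists_join L O B
      obtain ⟨j, hOj, hjl, hjh, hji, -⟩ := R.exists_line O l h i i
      have hBh := hB.1
      have hBj : B ∉ j := by grind
      obtain ⟨b₁, hb₁⟩ := exists_perspFrom hBh hBj
      obtain ⟨b₂, hb₂⟩ := exists_perspFrom hBj hB.2.1
      obtain rfl : b₁.trans b₂ = b := (hb₁.trans hb₂).unique hB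
      exact ⟨j, a.trans b₁, b₂.trans c,
        H.isPerspectivity_trans_of_concurrent R ha hb₁.isPerspectivity hjl.symm hOl hOh hOj,
        H.isPerspectivity_trans_of_concurrent R hb₂.isPerspectivity hc hjh hOj hOl hOh, rfl⟩
    · obtain ⟨O, hOn, hOh⟩ := exists_meet P n h
      by_cases hOl : O ∈ l
      · exact ⟨h, a, b.trans c, ha,
          H.isPerspectivity_trans_of_concurrent R hb hc hhn hOh hOl hOn, rfl⟩
      · exact H.isTwoStep_of_not_concurrent' R ha hb hc hhn hOn hOh hOl
  obtain ⟨O, hOl, hOk⟩ := exists_meet P l k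
  by_cases hOn : O ∈ n
  swap
  · exact H.isTwoStep_of_not_concurrent R ha hb hc hlk hOl hOk hOn
  by_cases hOh : O ∈ h
  · exact ⟨k, _, _, H.isPerspectivity_trans_of_concurrent R ha hb hlk hOl hOh hOk, hc, rfl⟩
  obtain ⟨Q, hQn, hQh⟩ := exists_meet P n h
  exact H.isTwoStep_of_not_concurrent' R ha hb hc (by grind) hQn hQh (by grind)

/-- A product of four perspectivities `l → h → n → l → m` with `l ≠ m` is a product of two. -/
theorem PappusTheorem.isTwoStep_trans_trans (H : PappusTheorem P L) (R : FivePoints P L)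
    {l n m : L} {f : PointsOn P L l ≃ PointsOn P L n} {c : PointsOn P L n ≃ PointsOn P L l}
    {d : PointsOn P L l ≃ PointsOn P L m} (hf : IsTwoStep f) (hc : IsPerspectivity c)
    (hd : IsPerspectivity d) (hlm : l ≠ m) : IsTwoStep ((f.trans c).trans d) := by
  -- if the first middle line is not `m`, the last three perspectivities are merged at first
  have main : ∀ {h : L} {a : PointsOn P L l ≃ PointsOn P L h} {b : PointsOn P L h ≃ PointsOn P L n},
      IsPerspectivity a → IsPerspectivity b → h ≠ m →
        IsTwoStep (((a.trans b).trans c).trans d) := by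
    intro h a b ha hb hhm
    obtain ⟨x, p, q, hp, hq, e⟩ := H.isTwoStep_trans R ⟨n, b, c, hb, hc, rfl⟩ hd hhm
    have := H.isTwoStep_trans R ⟨h, a, p, ha, hp, rfl⟩ hq hlm
    rwa [Equiv.trans_assoc a p, e] at this
  obtain ⟨h, a, b, ha, hb, rfl⟩ := hf
  by_cases hhm : h = m
  swap
  · exact main ha hb hhm
  subst hhm
  by_cases hhn : h = n
  · subst hhn
    rw [hb.eq_refl, Equiv.trans_refl]
    exact H.isTwoStep_trans R ⟨_, _, _, ha, hc, rfl⟩ hd hlm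
  -- otherwise the middle line is turned about its intersection with `n`
  obtain ⟨A, hA⟩ : ∃ A, PerspFrom A a := ha
  obtain ⟨K, hKh, hKn⟩ := exists_meet P h n
  obtain ⟨i, hKi, hAi⟩ := exists_join L K A
  obtain ⟨j, hKj, hjh, hjn, hji, -⟩ := R.exists_line K h n i i
  have hAh := hA.2.1
  have hAj : A ∉ j := by grind
  obtain ⟨a₁, ha₁⟩ := exists_perspFrom hA.1 hAj
  obtain ⟨a₂, ha₂⟩ := exists_perspFrom hAj hAh
  obtain rfl : a₁.trans a₂ = a := (ha₁.trans ha₂).unique hA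
  exact main (a := a₁) ha₁.isPerspectivity
    (H.isPerspectivity_trans_of_concurrent R ha₂.isPerspectivity hb hjn hKj hKh hKn) hjh

/-- A projectivity between distinct lines is a product of two perspectivities. -/
theorem PappusTheorem.isTwoStep_of_isProjectivity (H : PappusTheorem P L) (R : FivePoints P L)
    {l n : L} {f : PointsOn P L l ≃ PointsOn P L n} (hf : IsProjectivity f) (hln : l ≠ n) :
    IsTwoStep f := by
  -- for the induction, a statement on projectivities of a line onto itself is added
  suffices h : (l ≠ n → IsTwoStep f) ∧ ∀ (m : L) (p : PointsOn P L n ≃ PointsOn P L m), l = n →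
      l ≠ m → IsPerspectivity p → IsTwoStep (f.trans p) from h.1 hln
  clear hln
  induction hf with
  | refl => exact ⟨fun h => absurd rfl h, fun m p _ _ hp => by simpa using hp.isTwoStep⟩
  | @step n k f c hf hc ih =>
    refine ⟨fun hlk => ?_, fun m p hlk hlm hp => ?_⟩
    · by_cases hln : l = n
      · exact ih.2 k c hln hlk hc
      · exact H.isTwoStep_trans R (ih.1 hln) hc hlk
    · subst hlk
      by_cases hln : l = n
      · subst hln
        rw [hc.eq_refl, Equiv.trans_refl]
        exact ih.2 m p rfl hlm hp
      · exact H.isTwoStep_trans_trans R (ih.1 hln) hc hp hlm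

/-! ### Projectivities with fixed points -/

theorem PappusTheorem.isPerspectivity_of_fixed (H : PappusTheorem P L) (R : FivePoints P L)
    {l n : L} {f : PointsOn P L l ≃ PointsOn P L n} (hf : IsProjectivity f) (hln : l ≠ n) {E : P}
    (hEl : E ∈ l) (hEn : E ∈ n) (hE : f ⟨E, hEl⟩ = ⟨E, hEn⟩) : IsPerspectivity f := by
  obtain ⟨h, a, b, ha, hb, rfl⟩ := H.isTwoStep_of_isProjectivity R hf hln
  by_cases hEh : E ∈ h
  · exact H.isPerspectivity_trans_of_concurrent R ha hb hln hEl hEh hEn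
  · exact H.isPerspectivity_trans ha hb hln hEl hEn hEh hE

theorem PappusTheorem.eq_refl_of_fixed (H : PappusTheorem P L) (R : FivePoints P L)
    {l : L} {f : PointsOn P L l ≃ PointsOn P L l} (hf : IsProjectivity f) {A B C : PointsOn P L l}
    (hAB : A ≠ B) (hAC : A ≠ C) (hBC : B ≠ C) (hA : f A = A) (hB : f B = B) (hC : f C = C) :
    f = Equiv.refl _ := by
  obtain ⟨n, hAn, hnl, -⟩ := exists_third_line L A.1 l l
  obtain ⟨S, hSl, hSn⟩ := exists_off_two_lines P l n
  obtain ⟨p, hp⟩ := exists_perspFrom hSl hSn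
  have hpA : p A = ⟨A.1, hAn⟩ := hp.apply_self A.2 hAn
  -- the product with a perspectivity of `l` onto another line through `A` is a perspectivity,
  -- and its centre is the old one
  obtain ⟨T, hT⟩ : ∃ T, PerspFrom T (f.trans p) :=
    H.isPerspectivity_of_fixed R (hf.step hp.isPerspectivity) hnl.symm A.2 hAn (by simp [hA, hpA])
  obtain ⟨r, hr₁, hr₂, hr₃⟩ := hp.2.2 B
  obtain ⟨s, hs₁, hs₂, hs₃⟩ := hp.2.2 C
  obtain ⟨r', hr₁', hr₂', hr₃'⟩ := hT.2.2 B
  obtain ⟨s', hs₁', hs₂', hs₃'⟩ := hT.2.2 C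
  rw [Equiv.trans_apply, hB] at hr₃'
  rw [Equiv.trans_apply, hC] at hs₃'
  have hBn := (p B).2
  have hCn := (p C).2
  have hpBC := p.injective.ne hBC
  have hA₁ := A.2
  have hB₁ := B.2
  have hC₁ := C.2
  rw [Ne, Subtype.ext_iff] at hAB hAC hBC hpBC
  obtain rfl : S = T := by grind
  have key := hT.unique hp
  ext X
  exact congrArg Subtype.val (p.injective (DFunLike.congr_fun key X))

omit [ProjectivePlane P L] in
/-- A permutation of at most four points with three fixed points is the identity. -/
theorem eq_refl_of_fixed_of_forall_eq {l : L} (f : PointsOn P L l ≃ PointsOn P L l)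
    {A B C : PointsOn P L l} (hAB : A ≠ B) (hAC : A ≠ C) (hBC : B ≠ C) (hA : f A = A) (hB : f B = B)
    (hC : f C = C) {a b c d : P} (h : ∀ X ∈ l, X = a ∨ X = b ∨ X = c ∨ X = d) :
    f = Equiv.refl _ := by
  ext X
  by_contra hX
  have inj : ∀ Y : PointsOn P L l, X ≠ Y → (f X).1 ≠ (f Y).1 := fun Y hY e =>
    hY (f.injective (Subtype.ext e))
  have n₁ : X ≠ A := by rintro rfl; exact hX (congrArg _ hA)
  have n₂ : X ≠ B := by rintro rfl; exact hX (congrArg _ hB)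
  have n₃ : X ≠ C := by rintro rfl; exact hX (congrArg _ hC)
  have m₁ := inj A n₁
  have m₂ := inj B n₂
  have m₃ := inj C n₃
  rw [hA] at m₁
  rw [hB] at m₂
  rw [hC] at m₃
  rw [Ne, Subtype.ext_iff] at n₁ n₂ n₃ hAB hAC hBC
  have h₁ := h _ A.2
  have h₂ := h _ B.2
  have h₃ := h _ C.2
  have h₄ := h _ X.2
  have h₅ := h _ (f X).2
  rw [Equiv.refl_apply] at hX
  generalize (f X).1 = X' at *
  clear inj h hA hB hC
  grind

theorem FundamentalTheorem.of_pappus (H : PappusTheorem P L) : FundamentalTheorem P L := by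
  intro g g' A B C A' B' C' hAB hAC hBC hAB' hAC' hBC'
  refine existsUnique_of_exists_of_unique
    (exists_projectivity A B C A' B' C' hAB hAC hBC hAB' hAC' hBC') ?_
  rintro f₁ f₂ ⟨h₁, h₁A, h₁B, h₁C⟩ ⟨h₂, h₂A, h₂B, h₂C⟩
  suffices e : f₁.trans f₂.symm = Equiv.refl _ by
    ext X
    have := DFunLike.congr_fun e X
    rw [Equiv.trans_apply, Equiv.symm_apply_eq] at this
    rw [this, Equiv.refl_apply]
  have hA : (f₁.trans f₂.symm) A = A := by simp [h₁A, ← h₂A]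
  have hB : (f₁.trans f₂.symm) B = B := by simp [h₁B, ← h₂B]
  have hC : (f₁.trans f₂.symm) C = C := by simp [h₁C, ← h₂C]
  by_cases R : FivePoints P L
  · exact H.eq_refl_of_fixed R (h₁.trans h₂.symm) hAB hAC hBC hA hB hC
  · -- some line, and hence the line `g`, has at most four points
    simp only [FivePoints, not_forall, not_exists] at R
    obtain ⟨l, a, b, c, d, hl⟩ := R
    obtain ⟨S, hSg, hSl⟩ := exists_off_two_lines P g l
    obtain ⟨q, -⟩ := exists_perspFrom hSg hSl
    have key := eq_refl_of_fixed_of_forall_eq ((q.symm.trans (f₁.trans f₂.symm)).trans q)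
      (q.injective.ne hAB) (q.injective.ne hAC) (q.injective.ne hBC)
      (by rw [Equiv.trans_apply, Equiv.trans_apply, Equiv.symm_apply_apply, hA])
      (by rw [Equiv.trans_apply, Equiv.trans_apply, Equiv.symm_apply_apply, hB])
      (by rw [Equiv.trans_apply, Equiv.trans_apply, Equiv.symm_apply_apply, hC])
      (a := a) (b := b) (c := c) (d := d) (fun X hX => by have := hl X; tauto)
    ext X
    have := DFunLike.congr_fun key (q X)
    rw [Equiv.trans_apply, Equiv.trans_apply, Equiv.symm_apply_apply, Equiv.refl_apply,
      EmbeddingLike.apply_eq_iff_eq] at this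
    rw [this, Equiv.refl_apply]

theorem pappus_iff_fundamental (P : Type u) (L : Type v) [Membership P L] [ProjectivePlane P L] :
    PappusTheorem P L ↔ FundamentalTheorem P L :=
  ⟨.of_pappus, .of_fundamental⟩

end ProjectivePlane

end PappusFundamental

theorem mainTheorem5 :
    (∀ (P : Type u) (L : Type v) [Membership P L] [Configuration.ProjectivePlane P L],
      PappusFundamental.PappusTheorem P L ↔ PappusFundamental.FundamentalTheorem P L) ∧
    (∀ (P : Type u) (L : Type v) [Membership P L] [PappusFundamental.AffinePlane P L],
      PappusFundamental.PappusTheorem (PappusFundamental.ExtPoint P L)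
          (PappusFundamental.ExtLine L) ↔
        PappusFundamental.FundamentalTheorem (PappusFundamental.ExtPoint P L)
          (PappusFundamental.ExtLine L)) := by
  exact ⟨fun P L _ _ => PappusFundamental.pappus_iff_fundamental P L,
    fun P L _ _ => PappusFundamental.pappus_iff_fundamental _ _⟩
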